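/- Let $n>1$ be an integer, let $\sqrt[n]{2}$ be the positive real $n$-th root of $2$, and let $\mathbb{Z}[\sqrt[n]{2}]\subset\mathbb{R}$ be the subring generated by it. Let $A$ be the additive group (under termwise addition) of all sequences $(a_0,a_1,a_2,\dots)$ of elements of $\mathbb{Z}[\sqrt[n]{2}]$ that are bounded in the real absolute value, i.e. for which there is a real $C$ with $|a_k|\le C$ for all $k$. Let $B=A\oplus\mathbb{Z}$. Then, as abelian groups: 1. $A\cong A\oplus\mathbb{Z}^n$; 2. $A\not\cong A\oplus\mathbb{Z}^m$ for every integer $m$ with $0<m<n$; 3. $B$ is isomorphic to the direct sum $B^{n+1}$ of $n+1$ copies of itself; 4. $B$ is not isomorphic to the direct sum $B^{m+1}$ of $m+1$ copies of itself for any integer $m$ with $0<m<n$. -/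

import Mathlib

/-- The ring `ℤ[2^{1/n}]`: the subring of `ℝ` generated by the positive real `n`-th root of `2`. -/
noncomputable abbrev ZRoot (n : ℕ) : Subalgebra ℤ ℝ :=
  Algebra.adjoin ℤ {(2 : ℝ) ^ ((1 : ℝ) / (n : ℝ))}

/-- The additive group of bounded sequences, in the real absolute value, of elements of
`ℤ[2^{1/n}]`. -/
noncomputable def BddSeq (n : ℕ) : AddSubgroup (ℕ → ZRoot n) where
  carrier := {a | ∃ C : ℝ, ∀ k, |(a k : ℝ)| ≤ C}
  zero_mem' := ⟨0, fun k => by simp⟩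
  add_mem' := by
    rintro a b ⟨C, hC⟩ ⟨D, hD⟩
    exact ⟨C + D, fun k => (abs_add_le _ _).trans (add_le_add (hC k) (hD k))⟩
  neg_mem' := by
    rintro a ⟨C, hC⟩
    exact ⟨C, fun k => (abs_neg _).trans_le (hC k)⟩

/-- The group `A ⊕ ℤ`, where `A` is the group of bounded sequences in `ℤ[2^{1/n}]`. -/
abbrev BddSeqPlusInt (n : ℕ) : Type := BddSeq n × ℤ

/-!
Write `r = 2^{1/n}`, `R = ℤ[r]` and `A` for the group of bounded sequences in `R`. As a group `R` is
free of rank `n`, and splitting off the first term of a sequence gives `A ≃ A ⊕ R ≃ A ⊕ ℤ^n`.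
Interleaving gives `A ≃ A^k` for `k ≥ 1`, so the claims on `A ⊕ ℤ` reduce to those on `A`.

For the negative part, `A ≃ A ⊕ ℤ^m` yields a surjective endomorphism `P` of `A` with kernel of rank
`m`. The endomorphism need not be `R`-linear, but it is `R`-linear on the sequences that vanish at
the first `J` indices, for some `J` (`BddSeq.exists_map_smul_eq_on_tail`). Since `A` modulo these
sequences has finite rank, the rank of `ker P` is an alternating sum of ranks of `R`-modules of
finite rank, each of which is divisible by `n` (`finrank_dvd_finrank_ker`). Hence `n ∣ m`.

The near-linearity of `P` rests on the density of `R` in `ℝ`, where `n > 1` is needed. First, a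
homomorphism `A → ℤ` depends on finitely many terms only
(`BddSeq.exists_forall_mem_tail_map_eq_zero_int`), as for the product `ℤ^ℕ`; density supplies
elements that stay small after multiplication by large integers. Second, an additive functional
`A → ℝ` that is bounded on small elements is continuous, hence `R`-homogeneous
(`BddSeq.map_smul_of_bounded`). If for every `J` some coordinate of `P` were not `R`-homogeneous
on the sequences vanishing at the first `J` indices, a gliding hump would produce a sequence in `A`
whose image under `P` is unbounded.
-/

open Module

/-! ### Ranks of modules over an order -/

/-- Ranks are multiplicative along `ℤ → R` for arbitrary `R`-modules, not only free ones: modulo a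
maximal free `R`-submodule everything is `R`-torsion, hence `ℤ`-torsion. -/
theorem rank_int_eq_finrank_mul_rank {R M : Type} [CommRing R] [IsDomain R] [Module.Free ℤ R]
    [Module.Finite ℤ R] [AddCommGroup M] [Module R M] :
    Module.rank ℤ M = finrank ℤ R * Module.rank R M := by
  obtain ⟨s, hli, hmax⟩ := exists_maximal_linearIndepOn R (id : M → M)
  rw [Set.image_id] at hmax
  have hli' : LinearIndependent R ((↑) : s → M) := hli
  have hfree : Module.Free R (Submodule.span R s) := by
    have b := Basis.span hli'
    rw [Subtype.range_coe] at b
    exact Module.Free.of_basis b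
  have hs : s ⊆ Submodule.span R s := Submodule.subset_span
  generalize Submodule.span R s = N at hmax hfree hs
  have htors : Module.IsTorsion R (M ⧸ N) := by
    intro x
    obtain ⟨x, rfl⟩ := N.mkQ_surjective x
    obtain ⟨a, ha, hax⟩ : ∃ a : R, a ≠ 0 ∧ a • x ∈ N := by
      by_cases hx : x ∈ s
      · exact ⟨1, one_ne_zero, by simpa using hs hx⟩
      · exact hmax x hx
    exact ⟨⟨a, mem_nonZeroDivisors_of_ne_zero ha⟩, (Submodule.Quotient.mk_eq_zero N).mpr hax⟩
  have htors' : Module.IsTorsion ℤ (M ⧸ N) := by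
    intro x
    obtain ⟨⟨a, ha⟩, hax⟩ := @htors x
    obtain ⟨z, hz, c, hc⟩ :=
      (Algebra.IsAlgebraic.isAlgebraic (R := ℤ) a).exists_nonzero_dvd ha
    refine ⟨⟨z, mem_nonZeroDivisors_of_ne_zero hz⟩, ?_⟩
    change z • x = 0
    rw [← algebraMap_smul R z x, hc, mul_comm, mul_smul]
    exact (congrArg (c • ·) hax).trans (smul_zero c)
  have hR := N.rank_quotient_add_rank
  rw [Module.rank_eq_zero_iff_isTorsion.mpr htors, zero_add] at hR
  have hZ := (N.restrictScalars ℤ).rank_quotient_add_rank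
  rw [(Submodule.Quotient.restrictScalarsEquiv ℤ N).rank_eq,
    Module.rank_eq_zero_iff_isTorsion.mpr htors', zero_add] at hZ
  rw [← hZ, ← hR, finrank_eq_rank]
  exact (rank_mul_rank ℤ R N).symm

theorem finrank_int_dvd_finrank (R M : Type) [CommRing R] [IsDomain R] [Module.Free ℤ R]
    [Module.Finite ℤ R] [AddCommGroup M] [Module R M] : finrank ℤ R ∣ finrank ℤ M :=
  ⟨finrank R M, by simp [finrank, rank_int_eq_finrank_mul_rank (R := R) (M := M)]⟩

/-- The index argument: `ker (P|S)`, `A ⧸ S` and `A ⧸ P S` are `R`-modules, and the `ℤ`-rank of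
`ker P` is an alternating sum of theirs. -/
theorem finrank_dvd_finrank_ker {R A : Type} [CommRing R] [IsDomain R] [Module.Free ℤ R]
    [Module.Finite ℤ R] [AddCommGroup A] [Module R A] (S : Submodule R A)
    (hS : Module.rank ℤ (A ⧸ S) < Cardinal.aleph0) (P : A →ₗ[ℤ] A)
    (hP : Function.Surjective P) (hK : Module.Finite ℤ (LinearMap.ker P))
    (hlin : ∀ (r : R), ∀ a ∈ S, P (r • a) = r • P a) :
    finrank ℤ R ∣ finrank ℤ (LinearMap.ker P) := by
  let T : S →ₗ[R] A :=
    { toFun := fun a => P a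
      map_add' := fun a b => by simp
      map_smul' := fun r a => by simpa using hlin r a a.2 }
  -- `g : A ⧸ S → A ⧸ P S` is surjective with kernel the image of `f : ker P → A ⧸ S`
  let f := (S.restrictScalars ℤ).mkQ ∘ₗ (LinearMap.ker P).subtype
  let h := ((LinearMap.range T).restrictScalars ℤ).mkQ ∘ₗ P
  have hle : S.restrictScalars ℤ ≤ LinearMap.ker h := by
    intro a ha
    exact (Submodule.Quotient.mk_eq_zero _).mpr ⟨⟨a, ha⟩, rfl⟩
  let g := (S.restrictScalars ℤ).liftQ h hle
  have hg : Function.Surjective g := by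
    intro y
    obtain ⟨y, rfl⟩ := Submodule.mkQ_surjective _ y
    obtain ⟨a, rfl⟩ := hP y
    exact ⟨Submodule.mkQ _ a, rfl⟩
  have hgf : LinearMap.ker g = LinearMap.range f := by
    ext y
    obtain ⟨a, rfl⟩ := Submodule.mkQ_surjective _ y
    constructor
    · intro ha
      obtain ⟨s, hs⟩ := (Submodule.Quotient.mk_eq_zero _).mp
        (show Submodule.Quotient.mk (P a) = 0 from ha)
      have hs' : P s = P a := hs
      refine ⟨⟨a - s, by simp [hs']⟩, ?_⟩
      refine (Submodule.Quotient.eq _).mpr ?_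
      simp
    · rintro ⟨⟨k, hk⟩, hka⟩
      rw [← hka]
      change Submodule.Quotient.mk (P k) = 0
      rw [LinearMap.mem_ker.mp hk]; rfl
  have ef : LinearMap.ker f ≃+ LinearMap.ker T :=
    { toFun := fun x => ⟨⟨x.1.1, (Submodule.Quotient.mk_eq_zero _).mp x.2⟩, x.1.2⟩
      invFun := fun y => ⟨⟨y.1.1, y.2⟩, (Submodule.Quotient.mk_eq_zero _).mpr y.1.2⟩
      left_inv := fun _ => rfl
      right_inv := fun _ => rfl
      map_add' := fun _ _ => rfl }
  have e1 := LinearMap.rank_range_add_rank_ker f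
  have e2 := LinearMap.rank_range_add_rank_ker g
  rw [LinearMap.range_eq_top.mpr hg, rank_top, hgf,
    (Submodule.Quotient.restrictScalarsEquiv ℤ S).rank_eq,
    (Submodule.Quotient.restrictScalarsEquiv ℤ (LinearMap.range T)).rank_eq] at e2
  rw [ef.toIntLinearEquiv.rank_eq] at e1
  have hKlt := rank_lt_aleph0 ℤ (LinearMap.ker P)
  rw [← e1] at hKlt
  rw [← e2] at hS
  have n1 := congrArg Cardinal.toNat e1
  have n2 := congrArg Cardinal.toNat e2
  rw [Cardinal.toNat_add (lt_of_le_of_lt le_self_add hKlt)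
    (lt_of_le_of_lt le_add_self hKlt)] at n1
  rw [Cardinal.toNat_add (lt_of_le_of_lt le_self_add hS)
    (lt_of_le_of_lt le_add_self hS)] at n2
  have d1 := finrank_int_dvd_finrank R (LinearMap.ker T)
  have d2 := finrank_int_dvd_finrank R (A ⧸ S)
  have d3 := finrank_int_dvd_finrank R (A ⧸ LinearMap.range T)
  unfold finrank at d1 d2 d3 ⊢
  rw [← n1]
  rw [← n2] at d2
  exact dvd_add ((Nat.dvd_add_right d3).mp d2) d1

/-! ### The ring `ℤ[2^{1/n}]` -/

open Polynomial in
/-- The minimal polynomial of `2^{1/n}` over `ℤ`; irreducibility is Eisenstein's criterion at `2`. -/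
theorem minpoly_two_rpow_one_div {n : ℕ} (hn : 1 < n) :
    minpoly ℤ ((2 : ℝ) ^ ((1 : ℝ) / (n : ℝ))) = X ^ n - C 2 ∧
      IsIntegral ℤ ((2 : ℝ) ^ ((1 : ℝ) / (n : ℝ))) := by
  have hmonic : (X ^ n - C 2 : ℤ[X]).Monic := monic_X_pow_sub_C 2 (by omega)
  have hdeg : (X ^ n - C 2 : ℤ[X]).natDegree = n := natDegree_X_pow_sub_C
  have hroot : aeval ((2 : ℝ) ^ ((1 : ℝ) / (n : ℝ))) (X ^ n - C 2 : ℤ[X]) = 0 := by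
    have : ((2 : ℝ) ^ ((1 : ℝ) / (n : ℝ))) ^ n = 2 := by
      rw [one_div, Real.rpow_inv_natCast_pow (by norm_num) (by omega)]
    rw [map_sub, map_pow, aeval_X, aeval_C, this]; simp
  have hint : IsIntegral ℤ ((2 : ℝ) ^ ((1 : ℝ) / (n : ℝ))) := ⟨_, hmonic, hroot⟩
  have hE : (X ^ n - C 2 : ℤ[X]).IsEisensteinAt (Ideal.span {2}) := by
    refine hmonic.isEisensteinAt_of_mem_of_notMem ?_ ?_ ?_
    · rw [Ne, Ideal.span_singleton_eq_top]; decide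
    · intro i hi
      rw [hdeg] at hi
      rw [Ideal.mem_span_singleton, coeff_sub, coeff_X_pow, if_neg hi.ne, coeff_C]
      split_ifs <;> simp
    · rw [Ideal.span_singleton_pow, Ideal.mem_span_singleton, coeff_sub, coeff_X_pow,
        if_neg (by omega), coeff_C, if_pos rfl]
      decide
  have hirr : Irreducible (X ^ n - C 2 : ℤ[X]) :=
    hE.irreducible ((Ideal.span_singleton_prime (by decide)).mpr Int.prime_two)
      hmonic.isPrimitive (by omega)
  have hdvd := minpoly.isIntegrallyClosed_dvd hint hroot
  have hassoc := (minpoly.prime_of_isIntegrallyClosed hint).irreducible.associated_of_dvd hirr hdvd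
  exact ⟨eq_of_monic_of_associated (minpoly.monic hint) hmonic hassoc, hint⟩

/-- The powers `1, r, …, r ^ (n - 1)` of `r = 2^{1/n}` as a `ℤ`-basis. -/
theorem nonempty_basis_ZRoot {n : ℕ} (hn : 1 < n) : Nonempty (Basis (Fin n) ℤ (ZRoot n)) := by
  obtain ⟨h, hint⟩ := minpoly_two_rpow_one_div hn
  have b := (Algebra.adjoin.powerBasis' hint).basis
  rw [Algebra.adjoin.powerBasis'_dim, h, Polynomial.natDegree_X_pow_sub_C] at b
  exact ⟨b⟩

/-- Each `M ℤ[2^{1/n}]` with `M > 0` is dense in `ℝ`: the powers of `2^{1/n} - 1` tend to `0`. -/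
theorem exists_abs_sub_natCast_mul_lt {n : ℕ} (hn : 1 < n) (x : ℝ) {M : ℕ} (hM : 0 < M) {δ : ℝ}
    (hδ : 0 < δ) : ∃ u : ZRoot n, |x - M * (u : ℝ)| < δ := by
  set r : ℝ := (2 : ℝ) ^ ((1 : ℝ) / (n : ℝ)) with hr
  have hn' : (1 : ℝ) < n := by exact_mod_cast hn
  have h1 : 1 < r := Real.one_lt_rpow (by norm_num) (by positivity)
  have h2 : r < 2 := by
    have := Real.rpow_lt_rpow_of_exponent_lt (x := 2) (by norm_num)
      (show (1 : ℝ) / n < 1 by rw [div_lt_one (by linarith)]; exact hn')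
    rwa [Real.rpow_one] at this
  have hM' : (0 : ℝ) < M := by exact_mod_cast hM
  obtain ⟨k, hk⟩ := exists_pow_lt_of_lt_one (div_pos hδ hM') (show r - 1 < 1 by linarith)
  have ht : 0 < (r - 1) ^ k := pow_pos (by linarith) k
  rw [lt_div_iff₀ hM'] at hk
  let s : ZRoot n := ⟨r, Algebra.subset_adjoin rfl⟩ - 1
  refine ⟨⌊x / (M * (r - 1) ^ k)⌋ • s ^ k, ?_⟩
  have hcoe : ((⌊x / (M * (r - 1) ^ k)⌋ • s ^ k : ZRoot n) : ℝ)
      = ⌊x / (M * (r - 1) ^ k)⌋ * (r - 1) ^ k := by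
    simp [s]
  have hpos : 0 < M * (r - 1) ^ k := by positivity
  have hx : x = x / (M * (r - 1) ^ k) * (M * (r - 1) ^ k) := by field_simp
  have hfl := Int.floor_le (x / (M * (r - 1) ^ k))
  have hfr := Int.lt_floor_add_one (x / (M * (r - 1) ^ k))
  rw [hcoe]
  have heq : x - M * (⌊x / (M * (r - 1) ^ k)⌋ * (r - 1) ^ k)
      = (x / (M * (r - 1) ^ k) - ⌊x / (M * (r - 1) ^ k)⌋) * (M * (r - 1) ^ k) := by
    rw [sub_mul, ← hx]; ring
  rw [heq, abs_of_nonneg (mul_nonneg (by linarith) hpos.le)]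
  nlinarith

/-! ### Bounded sequences as a module over `ℤ[2^{1/n}]` -/

namespace BddSeq

/-- Termwise multiplication by a fixed element of `ℤ[2^{1/n}]`. -/
noncomputable instance (n : ℕ) : SMul (ZRoot n) (BddSeq n) where
  smul r a := ⟨r • a.1, by
    obtain ⟨C, hC⟩ := a.2
    refine ⟨|(r : ℝ)| * C, fun k => ?_⟩
    simpa [abs_mul] using mul_le_mul_of_nonneg_left (hC k) (abs_nonneg (r : ℝ))⟩

noncomputable instance (n : ℕ) : Module (ZRoot n) (BddSeq n) :=
  Function.Injective.module (ZRoot n) (BddSeq n).subtype Subtype.val_injective fun _ _ => rfl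

@[simp] theorem smul_apply {n : ℕ} (r : ZRoot n) (a : BddSeq n) (j : ℕ) :
    (r • a).1 j = r * a.1 j := rfl

@[simp] theorem add_apply {n : ℕ} (a b : BddSeq n) (j : ℕ) : (a + b).1 j = a.1 j + b.1 j := rfl

@[simp] theorem sub_apply {n : ℕ} (a b : BddSeq n) (j : ℕ) : (a - b).1 j = a.1 j - b.1 j := rfl

@[simp] theorem nsmul_apply {n : ℕ} (m : ℕ) (a : BddSeq n) (j : ℕ) :
    (m • a).1 j = m * a.1 j := by
  rw [← nsmul_eq_mul]; rfl

@[simp] theorem zsmul_apply {n : ℕ} (m : ℤ) (a : BddSeq n) (j : ℕ) :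
    (m • a).1 j = m * a.1 j := by
  rw [← zsmul_eq_mul]; rfl

/-- The evaluation homomorphism at the index `j`. -/
noncomputable def eval (n j : ℕ) : BddSeq n →+ ZRoot n :=
  (Pi.evalAddMonoidHom (fun _ => ZRoot n) j).comp (BddSeq n).subtype

/-- The sequences whose terms of index less than `N` vanish. -/
noncomputable def tail (n N : ℕ) : Submodule (ZRoot n) (BddSeq n) where
  carrier := {a | ∀ j < N, a.1 j = 0}
  zero_mem' := fun _ _ => rfl
  add_mem' := fun ha hb j hj => by simp [ha j hj, hb j hj]
  smul_mem' := fun r a ha j hj => by simp [ha j hj]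

theorem tail_anti {n M N : ℕ} (h : M ≤ N) : tail n N ≤ tail n M :=
  fun _ ha j hj => ha j (hj.trans_le h)

/-! ### Small sequences and continuity of functionals -/

/-- Division with small remainder, which is possible because `ℤ[2^{1/n}]` is dense in `ℝ`. -/
theorem exists_eq_nsmul_add {n : ℕ} (hn : 1 < n) {N : ℕ} {a : BddSeq n} (ha : a ∈ tail n N) {C : ℝ}
    (hC : ∀ j, |(a.1 j : ℝ)| ≤ C) {M : ℕ} (hM : 0 < M) {δ : ℝ} (hδ : 0 < δ) :
    ∃ u ∈ tail n N, ∃ v ∈ tail n N, a = M • u + v ∧ (∀ j, M * |(u.1 j : ℝ)| ≤ C + δ) ∧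
      ∀ j, |(v.1 j : ℝ)| ≤ δ := by
  have key : ∀ j, ∃ u : ZRoot n, |(a.1 j : ℝ) - M * (u : ℝ)| ≤ δ ∧ (j < N → u = 0) := by
    intro j
    by_cases hj : j < N
    · exact ⟨0, by simp [ha j hj, hδ.le], fun _ => rfl⟩
    · obtain ⟨u, hu⟩ := exists_abs_sub_natCast_mul_lt hn (a.1 j) hM hδ
      exact ⟨u, hu.le, fun h => absurd h hj⟩
  choose u hu hu0 using key
  have hub : ∀ j, M * |(u j : ℝ)| ≤ C + δ := by
    intro j
    have h1 : |(M : ℝ) * u j| = M * |(u j : ℝ)| := by rw [abs_mul, Nat.abs_cast]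
    have h2 := abs_sub_abs_le_abs_sub ((M : ℝ) * u j) (a.1 j)
    rw [abs_sub_comm] at h2
    linarith [hu j, hC j]
  have hM' : (1 : ℝ) ≤ M := by exact_mod_cast hM
  let U : BddSeq n := ⟨u, C + δ, fun j =>
    (le_mul_of_one_le_left (abs_nonneg _) hM').trans (hub j)⟩
  have hU : U ∈ tail n N := fun j hj => hu0 j hj
  refine ⟨U, hU, a - M • U, sub_mem ha (nsmul_mem hU M), by abel, hub, fun j => ?_⟩
  simpa [U] using hu j

/-- A functional to `ℤ` that is nonzero on `tail n N` is nonzero on arbitrarily small elements. -/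
theorem exists_small_apply_ne_zero {n : ℕ} (hn : 1 < n) (f : BddSeq n →+ ℤ) {N : ℕ} {a : BddSeq n}
    (ha : a ∈ tail n N) (hfa : f a ≠ 0) {δ : ℝ} (hδ : 0 < δ) :
    ∃ b ∈ tail n N, (∀ j, |(b.1 j : ℝ)| ≤ δ) ∧ f b ≠ 0 := by
  obtain ⟨C, hC⟩ := a.2
  obtain ⟨u, -, v, hv, hauv, -, hvδ⟩ :=
    exists_eq_nsmul_add hn ha hC (Nat.succ_pos (f a).natAbs) hδ
  refine ⟨v, hv, hvδ, fun hfv => hfa ?_⟩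
  -- otherwise `f a` would be divisible by an integer larger than `|f a|`
  refine Int.eq_zero_of_abs_lt_dvd (m := ((f a).natAbs.succ : ℕ)) ⟨f u, ?_⟩ ?_
  · conv_lhs => rw [hauv]
    rw [map_add, hfv, map_nsmul, add_zero, nsmul_eq_mul]
  · push_cast; simp

/-- An additive functional that is bounded on the small elements of `tail n N` is homogeneous on
`tail n N`: it is additive and continuous. -/
theorem map_smul_of_bounded {n : ℕ} (hn : 1 < n) (φ : BddSeq n →+ ℝ) {N : ℕ} {δ C : ℝ} (hδ : 0 < δ)
    (hφ : ∀ b ∈ tail n N, (∀ j, |(b.1 j : ℝ)| ≤ δ) → |φ b| ≤ C) (r : ZRoot n) {a : BddSeq n}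
    (ha : a ∈ tail n N) : φ (r • a) = r * φ a := by
  obtain ⟨D, hD⟩ := a.2
  obtain ⟨M, hM⟩ := exists_nat_gt ((D + δ) / δ)
  have hD0 : 0 ≤ D := (abs_nonneg _).trans (hD 0)
  have hM0 : (0 : ℝ) < M := lt_of_le_of_lt (by positivity) hM
  rw [div_lt_iff₀ hδ] at hM
  have hbig : ∀ b ∈ tail n N, (∀ j, |(b.1 j : ℝ)| ≤ D) → |φ b| ≤ M * C + C := by
    intro b hb hbD
    obtain ⟨u, hu, v, hv, rfl, huδ, hvδ⟩ :=
      exists_eq_nsmul_add hn hb hbD (by exact_mod_cast hM0 : 0 < M) hδ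
    have h1 := hφ u hu fun j => by
      have := (huδ j).trans hM.le
      exact le_of_mul_le_mul_left this hM0
    have h2 := hφ v hv hvδ
    rw [map_add, map_nsmul, nsmul_eq_mul]
    refine (abs_add_le _ _).trans (add_le_add ?_ h2)
    rw [abs_mul, Nat.abs_cast]
    exact mul_le_mul_of_nonneg_left h1 hM0.le
  -- `q • r • a - p • a` with `p = ⌊q r⌋` is bounded independently of `q`
  have hq : ∀ q : ℕ, q * |φ (r • a) - r * φ a| ≤ M * C + C + |φ a| := by
    intro q
    set p : ℤ := ⌊q * (r : ℝ)⌋ with hp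
    have hp1 : |q * (r : ℝ) - p| ≤ 1 := by
      rw [abs_of_nonneg (by linarith [Int.floor_le (q * (r : ℝ))])]
      linarith [Int.lt_floor_add_one (q * (r : ℝ))]
    have h1 := hbig (q • r • a - p • a)
      (sub_mem (nsmul_mem (Submodule.smul_mem _ _ ha) _) (zsmul_mem ha _)) fun j => by
        have : (((q • r • a - p • a).1 j : ZRoot n) : ℝ) = (q * (r : ℝ) - p) * a.1 j := by
          simp; ring
        rw [this, abs_mul]
        exact (mul_le_of_le_one_left (abs_nonneg _) hp1).trans (hD j)
    rw [map_sub, map_nsmul, map_zsmul, nsmul_eq_mul, zsmul_eq_mul] at h1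
    have h2 : q * (φ (r • a) - r * φ a) =
        (q * φ (r • a) - p * φ a) - (q * (r : ℝ) - p) * φ a := by ring
    have h3 : q * |φ (r • a) - r * φ a| = |q * (φ (r • a) - r * φ a)| := by
      rw [abs_mul, Nat.abs_cast]
    rw [h3, h2]
    refine (abs_sub _ _).trans (add_le_add h1 ?_)
    rw [abs_mul]
    exact mul_le_of_le_one_left (abs_nonneg _) hp1
  by_contra hne
  have hpos : 0 < |φ (r • a) - r * φ a| := abs_pos.mpr (sub_ne_zero.mpr hne)
  obtain ⟨q, hq'⟩ := exists_nat_gt ((M * C + C + |φ a|) / |φ (r • a) - r * φ a|)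
  rw [div_lt_iff₀ hpos] at hq'
  exact absurd (hq q) (not_le.mpr hq')

/-! ### Homomorphisms to `ℤ` and endomorphisms -/

/-- A geometrically bounded series whose terms have supports moving to infinity has a sum in the
group of bounded sequences; `s i` are the partial sums. -/
theorem exists_limit {n : ℕ} (s : ℕ → BddSeq n) (J : ℕ → ℕ) (hJ : Monotone J) (hJ' : ∀ i, i ≤ J i)
    (h0 : s 0 = 0) (hs : ∀ i, s (i + 1) - s i ∈ tail n (J i))
    (hb : ∀ i j, |((s (i + 1) - s i).1 j : ℝ)| ≤ (1 / 2) ^ i) :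
    ∃ x : BddSeq n, ∀ i, x - s i ∈ tail n (J i) := by
  have htail : ∀ i m, i ≤ m → s m - s i ∈ tail n (J i) := by
    intro i m him
    induction m, him using Nat.le_induction with
    | base => simp
    | succ m him ih =>
      have := add_mem (tail_anti (hJ him) (hs m)) ih
      rwa [sub_add_sub_cancel] at this
  have hbd : ∀ i j, |((s i).1 j : ℝ)| ≤ 2 * (1 - (1 / 2) ^ i) := by
    intro i j
    induction i with
    | zero => simp [h0]
    | succ i ih =>
      have h1 : (((s (i + 1)).1 j : ZRoot n) : ℝ) =
          ((s (i + 1) - s i).1 j : ZRoot n) + ((s i).1 j : ZRoot n) := by simp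
      rw [h1]
      refine (abs_add_le _ _).trans ((add_le_add (hb i j) ih).trans (le_of_eq ?_))
      rw [pow_succ]; ring
  refine ⟨⟨fun j => (s (j + 1)).1 j, 2, fun j => (hbd _ j).trans ?_⟩, fun i j hj => ?_⟩
  · have : (0 : ℝ) < (1 / 2) ^ (j + 1) := by positivity
    linarith
  · rw [sub_apply, sub_eq_zero]
    change (s (j + 1)).1 j = _
    rcases le_total i (j + 1) with h | h
    · exact sub_eq_zero.mp (htail i (j + 1) h j hj)
    · exact (sub_eq_zero.mp (htail (j + 1) i h j (hJ' (j + 1)))).symm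

theorem dvd_map_of_forall_dvd {n : ℕ} (f : BddSeq n →+ ℤ) {N : ℕ} (hN : 0 < N) {z : BddSeq n}
    (hz : ∀ j, (N : ZRoot n) ∣ z.1 j) : (N : ℤ) ∣ f z := by
  choose y hy using hz
  obtain ⟨C, hC⟩ := z.2
  have hN' : (1 : ℝ) ≤ N := by exact_mod_cast hN
  let Y : BddSeq n := ⟨y, C, fun j => by
    have h := hC j
    have h1 : ((z.1 j : ZRoot n) : ℝ) = N * (y j : ℝ) := by rw [hy j]; simp
    rw [h1, abs_mul, Nat.abs_cast] at h
    exact (le_mul_of_one_le_left (abs_nonneg _) hN').trans h⟩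
  have hzY : z = N • Y := by
    ext j; rw [hy j, nsmul_apply]
  exact ⟨f Y, by rw [hzY, map_nsmul, nsmul_eq_mul]⟩

/-- Homomorphisms to `ℤ` depend on finitely many terms. If not, there is a sum `x` of multiples
`N k • b k`, with `N k` dividing `N (k + 1)` and growing fast, such that the congruences
`f x ≡ f (s k) mod N k` for the partial sums `s k` force `f (s k)` to be eventually constant. -/
theorem exists_forall_mem_tail_map_eq_zero_int {n : ℕ} (hn : 1 < n) (f : BddSeq n →+ ℤ) :
    ∃ N, ∀ a ∈ tail n N, f a = 0 := by
  by_contra! H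
  have H' : ∀ k N : ℕ, ∃ b ∈ tail n k, (∀ j, |(b.1 j : ℝ)| ≤ (1 / 2) ^ k / (N + 1)) ∧ f b ≠ 0 := by
    intro k N
    obtain ⟨a, ha, hfa⟩ := H k
    exact exists_small_apply_ne_zero hn f ha hfa (by positivity)
  choose b hbt hbb hbf using H'
  -- the states are the pairs `(N k, s k)`
  let st : ℕ → ℕ × BddSeq n := fun k => Nat.rec (1, 0) (fun k p =>
    (p.1 * ((f (p.2 + p.1 • b k p.1)).natAbs + k + 2), p.2 + p.1 • b k p.1)) k
  let N : ℕ → ℕ := fun k => (st k).1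
  let s : ℕ → BddSeq n := fun k => (st k).2
  have hs : ∀ k, s (k + 1) = s k + N k • b k (N k) := fun _ => rfl
  have hN : ∀ k, N (k + 1) = N k * ((f (s (k + 1))).natAbs + k + 2) := fun _ => rfl
  have hs' : ∀ k, s (k + 1) - s k = N k • b k (N k) := fun k => by rw [hs]; abel
  have hNpos : ∀ k, 0 < N k := by
    intro k
    induction k with
    | zero => exact Nat.one_pos
    | succ k ih => rw [hN]; positivity
  obtain ⟨x, hx⟩ := exists_limit s id monotone_id (fun _ => le_rfl) rfl
    (fun k => by rw [hs']; exact nsmul_mem (hbt _ _) _) (fun k j => by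
      have h := hbb k (N k) j
      rw [le_div_iff₀ (by positivity)] at h
      have h1 : (((N k • b k (N k)).1 j : ZRoot n) : ℝ) = N k * ((b k (N k)).1 j : ℝ) := by simp
      rw [hs', h1, abs_mul, Nat.abs_cast]
      nlinarith [abs_nonneg ((b k (N k)).1 j : ℝ)])
  have hNdvd : ∀ k m, k ≤ m → N k ∣ N m := by
    intro k m hkm
    induction m, hkm using Nat.le_induction with
    | base => exact dvd_rfl
    | succ m _ ih => rw [hN]; exact ih.mul_right _
  have hsdvd : ∀ k m, k ≤ m → ∀ j, (N k : ZRoot n) ∣ (s m - s k).1 j := by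
    intro k m hkm j
    induction m, hkm using Nat.le_induction with
    | base => simp
    | succ m hkm ih =>
      have h1 : s (m + 1) - s k = N m • b m (N m) + (s m - s k) := by rw [hs]; abel
      rw [h1, add_apply, nsmul_apply]
      exact dvd_add ((Nat.cast_dvd_cast (hNdvd k m hkm)).mul_right _) ih
  have hcong : ∀ k, (N k : ℤ) ∣ f x - f (s k) := by
    intro k
    rw [← map_sub]
    refine dvd_map_of_forall_dvd f (hNpos k) fun j => ?_
    have h1 := hsdvd k (max k (j + 1)) (le_max_left _ _) j
    have h2 : x.1 j = (s (max k (j + 1))).1 j :=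
      sub_eq_zero.mp (hx (max k (j + 1)) j (lt_max_of_lt_right j.lt_succ_self))
    rwa [sub_apply, h2, ← sub_apply]
  have heq : ∀ k, (f x).natAbs ≤ k → f x = f (s (k + 1)) := by
    intro k hk
    refine sub_eq_zero.mp (Int.eq_zero_of_abs_lt_dvd (hcong (k + 1)) ?_)
    have h1 : (f (s (k + 1))).natAbs + k + 2 ≤ N (k + 1) := by
      rw [hN]; exact Nat.le_mul_of_pos_left _ (hNpos k)
    rw [abs_lt]
    omega
  obtain ⟨k, hk⟩ : ∃ k, (f x).natAbs = k := ⟨_, rfl⟩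
  have h1 := heq k hk.le
  have h2 := heq (k + 1) (hk.le.trans k.le_succ)
  rw [hs (k + 1), map_add, ← h1, map_nsmul, nsmul_eq_mul, left_eq_add, mul_eq_zero] at h2
  exact h2.elim (by exact_mod_cast (hNpos (k + 1)).ne') (hbf (k + 1) (N (k + 1)))

theorem exists_forall_mem_tail_map_eq_zero {n : ℕ} (hn : 1 < n) (g : BddSeq n →+ ZRoot n) :
    ∃ N, ∀ a ∈ tail n N, g a = 0 := by
  obtain ⟨b⟩ := nonempty_basis_ZRoot hn
  choose N hN using fun i =>
    exists_forall_mem_tail_map_eq_zero_int hn ((b.coord i).toAddMonoidHom.comp g)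
  refine ⟨Finset.univ.sup N, fun a ha => b.ext_elem fun i => ?_⟩
  rw [map_zero]
  exact hN i a (tail_anti (Finset.le_sup (Finset.mem_univ i)) ha)

/-- Every additive endomorphism is linear over `ℤ[2^{1/n}]` on some `tail n J`, by a gliding hump
argument: otherwise some `x` would have an unbounded image. -/
theorem exists_map_smul_eq_on_tail {n : ℕ} (hn : 1 < n) (P : BddSeq n →+ BddSeq n) :
    ∃ J, ∀ (r : ZRoot n), ∀ a ∈ tail n J, P (r • a) = r • P a := by
  by_contra! H
  let φ : ℕ → BddSeq n →+ ℝ := fun k =>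
    ((ZRoot n).val.toRingHom : ZRoot n →+ ℝ).comp ((eval n k).comp P)
  have hφ : ∀ k a, φ k a = ((P a).1 k : ℝ) := fun _ _ => rfl
  have H' : ∀ J, ∃ k, ∀ (δ C : ℝ), 0 < δ →
      ∃ b ∈ tail n J, (∀ j, |(b.1 j : ℝ)| ≤ δ) ∧ C < |φ k b| := by
    intro J
    obtain ⟨r, a, ha, hne⟩ := H J
    obtain ⟨k, hk⟩ : ∃ k, (P (r • a)).1 k ≠ (r • P a).1 k := by
      by_contra! h
      exact hne (Subtype.ext (funext h))
    refine ⟨k, fun δ C hδ => ?_⟩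
    by_contra! h
    refine hk (Subtype.ext ?_)
    simpa [hφ] using map_smul_of_bounded hn (φ k) hδ h r ha
  choose k hk using H'
  choose b hbt hbb hbφ using fun J (i : ℕ) (s : BddSeq n) =>
    hk J ((1 / 2) ^ i) (i + |φ (k J) s|) (by positivity)
  choose N hN using fun k => exists_forall_mem_tail_map_eq_zero hn ((eval n k).comp P)
  -- the states are pairs `(J i, s i)`: the next hump is supported on the terms from `J i` on, and
  -- `N (k (J i)) ≤ J (i + 1)` makes the later humps invisible to the functional `φ (k (J i))`
  let st : ℕ → ℕ × BddSeq n := fun i => Nat.rec (0, 0) (fun i p =>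
    (max (p.1 + 1) (N (k p.1)), p.2 + b p.1 i p.2)) i
  let J : ℕ → ℕ := fun i => (st i).1
  let s : ℕ → BddSeq n := fun i => (st i).2
  have hs : ∀ i, s (i + 1) = s i + b (J i) i (s i) := fun _ => rfl
  have hJ : ∀ i, J (i + 1) = max (J i + 1) (N (k (J i))) := fun _ => rfl
  have hs' : ∀ i, s (i + 1) - s i = b (J i) i (s i) := fun i => by rw [hs]; abel
  have hJlt : ∀ i, J i < J (i + 1) := fun i => by rw [hJ]; omega
  obtain ⟨x, hx⟩ := exists_limit s J (monotone_nat_of_le_succ fun i => (hJlt i).le)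
    (fun _ => (strictMono_nat_of_lt_succ hJlt).le_apply) rfl
    (fun i => by rw [hs']; exact hbt _ _ _) (fun i j => by rw [hs']; exact hbb _ _ _ j)
  obtain ⟨C, hC⟩ := (P x).2
  obtain ⟨i, hi⟩ := exists_nat_gt C
  have h1 : φ (k (J i)) x = φ (k (J i)) (s (i + 1)) := by
    rw [← sub_eq_zero, ← map_sub, hφ]
    exact congrArg _ (hN (k (J i)) _
      (tail_anti (by rw [hJ]; exact le_max_right _ _) (hx (i + 1))))
  have h2 := hC (k (J i))
  rw [← hφ, h1, hs, map_add] at h2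
  have h3 := hbφ (J i) i (s i)
  have h4 := abs_sub_abs_le_abs_sub (φ (k (J i)) (b (J i) i (s i))) (-φ (k (J i)) (s i))
  rw [abs_neg, sub_neg_eq_add, add_comm (φ (k (J i)) (b (J i) i (s i)))] at h4
  linarith

end BddSeq

/-! ### The index obstruction -/

namespace BddSeq

theorem finite_quotient_tail {n : ℕ} (hn : 1 < n) (J : ℕ) :
    Module.Finite ℤ (BddSeq n ⧸ tail n J) := by
  obtain ⟨b⟩ := nonempty_basis_ZRoot hn
  have hfin : Module.Finite ℤ (ZRoot n) := Module.Finite.of_basis b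
  let T : BddSeq n →ₗ[ZRoot n] (Fin J → ZRoot n) :=
    { toFun := fun a j => a.1 j
      map_add' := fun _ _ => rfl
      map_smul' := fun _ _ => rfl }
  have hT : LinearMap.ker T = tail n J := by
    ext a
    exact ⟨fun h j hj => congrFun h ⟨j, hj⟩, fun h => funext fun j => h j j.2⟩
  rw [← hT]
  have hinj : Function.Injective ((LinearMap.ker T).liftQ T le_rfl) :=
    LinearMap.ker_eq_bot.mp (Submodule.ker_liftQ_eq_bot' _ _ rfl)
  exact Module.Finite.of_injective
    (((LinearMap.ker T).liftQ T le_rfl).toAddMonoidHom.toIntLinearMap) hinj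

/-- The kernel of `A ≃ A ⊕ ℤ^m → A` is `ℤ^m`, so its rank is a multiple of `n`. -/
theorem dvd_of_addEquiv_prod {n : ℕ} (hn : 1 < n) {m : ℕ}
    (e : BddSeq n ≃+ BddSeq n × (Fin m → ℤ)) : n ∣ m := by
  obtain ⟨b⟩ := nonempty_basis_ZRoot hn
  have hfree : Module.Free ℤ (ZRoot n) := Module.Free.of_basis b
  have hfin : Module.Finite ℤ (ZRoot n) := Module.Finite.of_basis b
  let P : BddSeq n →+ BddSeq n := (AddMonoidHom.fst _ _).comp e.toAddMonoidHom
  have hP : Function.Surjective P := fun a => ⟨e.symm (a, 0), by simp [P]⟩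
  let eK : (Fin m → ℤ) ≃+ LinearMap.ker P.toIntLinearMap :=
    { toFun := fun z => ⟨e.symm (0, z), by
        change (e (e.symm (0, z))).1 = 0
        rw [e.apply_symm_apply]⟩
      invFun := fun a => (e a.1).2
      left_inv := fun z => by simp
      right_inv := fun ⟨a, ha⟩ => by
        have h : (e a).1 = 0 := ha
        refine Subtype.ext (e.injective ?_)
        simp [← h]
      map_add' := fun z w => Subtype.ext <| by
        change e.symm _ = e.symm _ + e.symm _
        rw [← map_add]; simp }
  obtain ⟨J, hJ⟩ := exists_map_smul_eq_on_tail hn P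
  have hQ := finite_quotient_tail hn J
  have h := finrank_dvd_finrank_ker (tail n J) (rank_lt_aleph0 ℤ _) P.toIntLinearMap hP
    (Module.Finite.equiv eK.toIntLinearEquiv) hJ
  rwa [← eK.toIntLinearEquiv.finrank_eq, finrank_fin_fun, finrank_eq_card_basis b,
    Fintype.card_fin] at h

/-! ### Explicit isomorphisms -/

/-- A bounded sequence is the same as its first term followed by a bounded sequence. -/
noncomputable def consEquiv (n : ℕ) : BddSeq n ≃+ BddSeq n × ZRoot n where
  toFun a := (⟨fun j => a.1 (j + 1), a.2.imp fun _ hC j => hC (j + 1)⟩, a.1 0)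
  invFun p := ⟨fun j => Nat.casesOn j p.2 p.1.1, by
    obtain ⟨C, hC⟩ := p.1.2
    refine ⟨max |(p.2 : ℝ)| C, fun j => ?_⟩
    cases j with
    | zero => exact le_max_left _ _
    | succ j => exact (hC j).trans (le_max_right _ _)⟩
  left_inv a := by ext j; cases j <;> rfl
  right_inv p := rfl
  map_add' a b := rfl

/-- A finite family of bounded sequences is the same as one bounded sequence, by interleaving. -/
noncomputable def interleaveEquiv (n k : ℕ) : BddSeq n ≃+ (Fin (k + 1) → BddSeq n) where
  toFun a i := ⟨fun j => a.1 (Nat.divModEquiv (k + 1) |>.symm (j, i)),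
    a.2.imp fun _ hC j => hC _⟩
  invFun a := ⟨fun j => (a (Nat.divModEquiv (k + 1) j).2).1 (Nat.divModEquiv (k + 1) j).1, by
    choose C hC using fun i => (a i).2
    exact ⟨Finset.univ.sup' Finset.univ_nonempty C,
      fun j => (hC _ _).trans (Finset.le_sup' C (Finset.mem_univ _))⟩⟩
  left_inv a := by
    ext j
    exact congrArg (fun j => (a.1 j : ℝ)) ((Nat.divModEquiv (k + 1)).symm_apply_apply j)
  right_inv a := by
    funext i
    ext j
    exact congrArg (fun p => ((a p.2).1 p.1 : ℝ))
      ((Nat.divModEquiv (k + 1)).apply_symm_apply (j, i))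
  map_add' a b := rfl

theorem nonempty_addEquiv_prod {n : ℕ} (hn : 1 < n) :
    Nonempty (BddSeq n ≃+ BddSeq n × (Fin n → ℤ)) := by
  obtain ⟨b⟩ := nonempty_basis_ZRoot hn
  exact ⟨(consEquiv n).trans ((AddEquiv.refl _).prodCongr b.equivFun.toAddEquiv)⟩

/-- `(A ⊕ ℤ)^(k+1) ≃ (A ⊕ ℤ^k) ⊕ ℤ` for the group `A` of bounded sequences. -/
noncomputable def piPlusIntEquiv (n k : ℕ) :
    (Fin (k + 1) → BddSeqPlusInt n) ≃+ (BddSeq n × (Fin k → ℤ)) × ℤ where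
  toFun x := (((interleaveEquiv n k).symm fun i => (x i).1, fun i => (x i.succ).2), (x 0).2)
  invFun y i := (interleaveEquiv n k y.1.1 i, Fin.cons (α := fun _ => ℤ) y.2 y.1.2 i)
  left_inv x := by
    funext i
    refine Prod.ext (by simp) ?_
    cases i using Fin.cases <;> rfl
  right_inv y := by simp
  map_add' x y := by
    refine Prod.ext (Prod.ext ?_ rfl) rfl
    exact map_add (interleaveEquiv n k).symm (fun i => (x i).1) fun i => (y i).1

/-- `ℤ ⊕ ℤ^(n-1)` as `ℤ^n`. -/
noncomputable def consIntEquiv (k : ℕ) : ℤ × (Fin k → ℤ) ≃+ (Fin (k + 1) → ℤ) where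
  toFun p := Fin.cons p.1 p.2
  invFun z := (z 0, fun i => z i.succ)
  left_inv p := rfl
  right_inv z := Fin.cons_self_tail z
  map_add' p q := by funext i; cases i using Fin.cases <;> rfl

/-- The summand `ℤ` can be cancelled, as `A ≃ A ⊕ ℤ^n` absorbs `ℤ ⊕ ℤ^(n-1)`. -/
theorem nonempty_addEquiv_of_prod_int {n : ℕ} (hn : 1 < n) {m : ℕ}
    (e : BddSeqPlusInt n ≃+ (BddSeq n × (Fin m → ℤ)) × ℤ) :
    Nonempty (BddSeq n ≃+ BddSeq n × (Fin m → ℤ)) := by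
  obtain ⟨k, rfl⟩ : ∃ k, n = k + 1 := ⟨n - 1, by omega⟩
  obtain ⟨a⟩ := nonempty_addEquiv_prod hn
  let c := consIntEquiv k
  let A := BddSeq (k + 1)
  let Zm := Fin m → ℤ
  let Zk := Fin k → ℤ
  -- `A ≃ A ⊕ ℤ^n ≃ (A ⊕ ℤ) ⊕ ℤ^k ≃ ((A ⊕ ℤ^m) ⊕ ℤ) ⊕ ℤ^k ≃ (A ⊕ ℤ^m) ⊕ ℤ^n`
  let e1 : A ≃+ (A × Zm) × (Fin (k + 1) → ℤ) :=
    (a.trans ((AddEquiv.refl A).prodCongr c.symm)).trans <|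
      (AddEquiv.prodAssoc (M := A) (N := ℤ) (P := Zk)).symm.trans <|
      (e.prodCongr (AddEquiv.refl Zk)).trans <|
      (AddEquiv.prodAssoc (M := A × Zm) (N := ℤ) (P := Zk)).trans
        ((AddEquiv.refl (A × Zm)).prodCongr c)
  -- `(A ⊕ ℤ^m) ⊕ ℤ^n ≃ A ⊕ ℤ^m`
  let e2 : (A × Zm) × (Fin (k + 1) → ℤ) ≃+ A × Zm :=
    (AddEquiv.prodAssoc (M := A) (N := Zm) (P := Fin (k + 1) → ℤ)).trans <|
      ((AddEquiv.refl A).prodCongr AddEquiv.prodComm).trans <|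
      (AddEquiv.prodAssoc (M := A) (N := Fin (k + 1) → ℤ) (P := Zm)).symm.trans
        (a.symm.prodCongr (AddEquiv.refl Zm))
  exact ⟨e1.trans e2⟩

end BddSeq

theorem mainTheorem5 (n : ℕ) (hn : 1 < n) :
    Nonempty (BddSeq n ≃+ BddSeq n × (Fin n → ℤ)) ∧
    (∀ m : ℕ, 0 < m → m < n → ¬ Nonempty (BddSeq n ≃+ BddSeq n × (Fin m → ℤ))) ∧
    Nonempty (BddSeqPlusInt n ≃+ (Fin (n + 1) → BddSeqPlusInt n)) ∧
    (∀ m : ℕ, 0 < m → m < n →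
      ¬ Nonempty (BddSeqPlusInt n ≃+ (Fin (m + 1) → BddSeqPlusInt n))) := by
  have hnot : ∀ m : ℕ, 0 < m → m < n → ¬ Nonempty (BddSeq n ≃+ BddSeq n × (Fin m → ℤ)) :=
    fun m hm hmn ⟨e⟩ => Nat.not_dvd_of_pos_of_lt hm hmn (BddSeq.dvd_of_addEquiv_prod hn e)
  obtain ⟨a⟩ := BddSeq.nonempty_addEquiv_prod hn
  refine ⟨⟨a⟩, hnot, ⟨?_⟩, fun m hm hmn ⟨e⟩ => hnot m hm hmn ?_⟩
  · exact (a.prodCongr (AddEquiv.refl ℤ)).trans (BddSeq.piPlusIntEquiv n n).symm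
  · exact BddSeq.nonempty_addEquiv_of_prod_int hn (e.trans (BddSeq.piPlusIntEquiv n m))
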